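/- Let $\mathcal H$ be a separable Hilbert space with its Borel $\sigma$-algebra, and let $\mathcal M_1$ be the set of Borel probability measures on $\mathcal H$. A semimetric is a symmetric, lower semicontinuous function $d:\mathcal H\times\mathcal H\to[0,\infty)$ with $d(x,y)=0$ if and only if $x=y$. For a semimetric $d$ and $\mu,\nu\in\mathcal M_1$ put $$W_d(\mu,\nu)=\inf_\Gamma\int d(x,y)\,\Gamma(dx,dy)\in[0,\infty],$$ the infimum being over all probability measures $\Gamma$ on $\mathcal H\times\mathcal H$ with marginals $\mu$ and $\nu$. Let $(\mathcal P_t)_{t\ge0}$ be a Markov semigroup on $\mathcal H$ with transition probabilities $P_t(x,\cdot)$, and write $\mathcal P_t\mu=\int P_t(x,\cdot)\,\mu(dx)$ for $\mu\in\mathcal M_1$. Suppose that there is a continuous Lyapunov function $V:\mathcal H\to[0,\infty)$, that is, there are constants $C_V,\gamma_V,K_V>0$ with $$\int V(y)\,P_t(x,dy)\le C_Ve^{-\gamma_Vt}V(x)+K_V\qquad\text{for all }x\in\mathcal H,\ t\ge0.$$ Suppose further that there are a semimetric $d:\mathcal H\times\mathcal H\to[0,1]$, a nonempty open interval $(a,b)\subset(0,\infty)$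 and constants $\alpha\in[0,1)$, $\varepsilon\in(0,1]$ such that for every $T\in(a,b)$: 1. ($d$ is contracting for $\mathcal P_T$) $W_d(P_T(x,\cdot),P_T(y,\cdot))\le\alpha\,d(x,y)$ for all $x,y\in\mathcal H$ with $d(x,y)<1$; 2. (the level set $\{V\le4K_V\}$ is $d$-small for $\mathcal P_T$) $W_d(P_T(x,\cdot),P_T(y,\cdot))\le1-\varepsilon$ for all $x,y$ with $V(x)\le4K_V$ and $V(y)\le4K_V$. Put $\tilde d(x,y)=\sqrt{d(x,y)\,(1+V(x)+V(y))}$. Then there exist $\gamma>0$ and $t_0>0$ such that for all $\mu,\nu\in\mathcal M_1$ $$W_{\tilde d}(\mathcal P_t\mu,\mathcal P_t\nu)\le e^{-\gamma t}\,W_{\tilde d}(\mu,\nu)\qquad\text{for all }t\ge t_0.$$ Furthermore, if $\mu_*\in\mathcal M_1$ is invariant, i.e. $\mathcal P_t\mu_*=\mu_*$ for all $t\ge0$, then there exists $C>0$ such that $$W_{\tilde d}(P_t(x,\cdot),\mu_*)\le C\,(1+V(x))\,e^{-\gamma t}\qquad\text{for all }x\in\mathcal H,\ t\ge t_0.$$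 -/

import Mathlib

open MeasureTheory ProbabilityTheory
open scoped NNReal ENNReal

/-- A semimetric (distance-like function) on a topological space: a nonnegative function of two
variables which is symmetric, lower semicontinuous and vanishes exactly on the diagonal. -/
structure IsSemimetric {X : Type*} [TopologicalSpace X] (d : X → X → ℝ) : Prop where
  nonneg : ∀ x y, 0 ≤ d x y
  symm : ∀ x y, d x y = d y x
  lsc : LowerSemicontinuous fun p : X × X => d p.1 p.2
  eq_zero_iff : ∀ x y, d x y = 0 ↔ x = y

/-- `Γ` is a coupling of `μ` and `ν`: its two marginals are `μ` and `ν`. (If `μ` is a probability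
measure, then so is `Γ`.) -/
def IsCoupling {X : Type*} [MeasurableSpace X] (Γ : Measure (X × X)) (μ ν : Measure X) : Prop :=
  Γ.map Prod.fst = μ ∧ Γ.map Prod.snd = ν

/-- The Wasserstein semimetric `W_d(μ, ν)`, the infimum of `∫ d dΓ` over all couplings `Γ`
of `μ` and `ν`, for a nonnegative cost `d`. It takes values in `[0, ∞]`. -/
noncomputable def wassersteinSemimetric {X : Type*} [MeasurableSpace X] (d : X → X → ℝ)
    (μ ν : Measure X) : ℝ≥0∞ :=
  ⨅ (Γ : Measure (X × X)) (_ : IsCoupling Γ μ ν), ∫⁻ p, ENNReal.ofReal (d p.1 p.2) ∂Γ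

/-- A family of transition probabilities `P t x = P_t(x, ·)`, `t ≥ 0`, forming a Markov
semigroup. -/
structure IsMarkovSemigroup {X : Type*} [MeasurableSpace X] (P : ℝ≥0 → Kernel X X) : Prop where
  markov : ∀ t, IsMarkovKernel (P t)
  zero : P 0 = Kernel.id
  add : ∀ s t, P (s + t) = P t ∘ₖ P s

/-- `V` is a Lyapunov function for the semigroup with constants `C`, `κ`, `K`: it is nonnegative
and measurable, the constants are positive, and `(P_t V)(x) ≤ C e^{-κ t} V(x) + K`. The integral
`P_t V` is taken in `[0, ∞]`, so its finiteness is part of the condition. -/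
structure IsLyapunovFunction {X : Type*} [MeasurableSpace X] (P : ℝ≥0 → Kernel X X)
    (V : X → ℝ) (C κ K : ℝ) : Prop where
  measurable : Measurable V
  nonneg : ∀ x, 0 ≤ V x
  C_pos : 0 < C
  κ_pos : 0 < κ
  K_pos : 0 < K
  bound : ∀ (t : ℝ≥0) (x : X),
    ∫⁻ y, ENNReal.ofReal (V y) ∂(P t x) ≤ ENNReal.ofReal (C * Real.exp (-κ * t) * V x + K)

/-- `d` is contracting for the Markov operator with transition function `Q`, with
constant `α ∈ [0, 1)`. -/
def IsContractingWith {X : Type*} [MeasurableSpace X] (Q : Kernel X X) (d : X → X → ℝ)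
    (α : ℝ) : Prop :=
  0 ≤ α ∧ α < 1 ∧ ∀ x y, d x y < 1 →
    wassersteinSemimetric d (Q x) (Q y) ≤ ENNReal.ofReal (α * d x y)

/-- The set `S` is `d`-small for the Markov operator with transition function `Q`, with
constant `ε ∈ (0, 1]`. -/
def IsSmallWith {X : Type*} [MeasurableSpace X] (Q : Kernel X X) (d : X → X → ℝ) (S : Set X)
    (ε : ℝ) : Prop :=
  0 < ε ∧ ε ≤ 1 ∧ ∀ x ∈ S, ∀ y ∈ S,
    wassersteinSemimetric d (Q x) (Q y) ≤ ENNReal.ofReal (1 - ε)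

/-- The weighted semimetric `d̃(x, y) = √(d(x, y) (1 + V(x) + V(y)))`. -/
noncomputable def weightedSemimetric {X : Type*} (d : X → X → ℝ) (V : X → ℝ) (x y : X) : ℝ :=
  Real.sqrt (d x y * (1 + V x + V y))

/-! ### Weak convergence tested on open sets, and discretisation of parameters -/

section WeakConvergence

open Filter Topology TopologicalSpace

/-! This is a weak Harris argument. For small `β`, weight `d` by `1 + βV(x) + βV(y)`. By
Cauchy–Schwarz, a kernel `Q` with `QV ≤ V/4 + K` satisfies `W(Qx, Qy)² ≤ W_d(Qx, Qy) (1 + 2βK +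
β(V(x) + V(y))/4)`, where `W` is the Wasserstein semimetric of the square-root cost. If `d(x, y) <
1`, the first factor contracts; if `d = 1` and `V(x) + V(y) ≥ 4K`, the Lyapunov factor gains;
otherwise both points lie in the small set. This is `exists_weightedSemimetric_contraction`, whose
constants do not depend on `Q`.

Every large time is a multiple of some `T ∈ (a, b)`, and `W_d` is nonexpansive under `P T`, so the
one-step bound holds with the same rate at all times beyond some `t₁`. Cutting `t` into equal pieces
longer than `t₁` gives exponential decay; returning from weight `β` to weight `1` costs a constant,
absorbed by lowering the rate and taking `t₀` large. For the last claim, start from a Dirac mass and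
an invariant measure, which has finite `V`-moment.

Passing from points to measures is convexity of `W_c`, `wassersteinSemimetric_bind_le`. Measurable
selection of couplings is avoided: the parameter is discretised, couplings are mixed over `ℕ`, and
tightness and lower semicontinuity of the cost pass to the limit. -/

/-- In a second countable space, the measure of open sets is determined by a fixed sequence of open
sets through inner approximation. -/
theorem exists_seq_isOpen_forall_lt_measure (X : Type*) [TopologicalSpace X]
    [SecondCountableTopology X] [MeasurableSpace X] :
    ∃ U : ℕ → Set X, (∀ k, IsOpen (U k)) ∧ ∀ (m : Measure X) (G : Set X), IsOpen G →
      ∀ c < m G, ∃ k, U k ⊆ G ∧ c < m (U k) := by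
  have : Countable (countableBasis X) := (countable_countableBasis X).to_subtype
  obtain ⟨e, he⟩ := exists_surjective_nat (Finset (countableBasis X))
  refine ⟨fun k => ⋃ b ∈ e k, (b : Set X), fun k => isOpen_biUnion fun b _ =>
    isOpen_of_mem_countableBasis b.2, fun m G hG c hc => ?_⟩
  let W : Finset {b : countableBasis X // (b : Set X) ⊆ G} → Set X :=
    fun s => ⋃ b ∈ s, (b : Set X)
  have hGW : G = ⋃ s, W s := by
    apply Set.Subset.antisymm
    · intro x hx
      obtain ⟨b, hb, hxb, hbG⟩ := (isBasis_countableBasis X).exists_subset_of_mem_open hx hG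
      exact Set.mem_iUnion.2 ⟨{⟨⟨b, hb⟩, hbG⟩}, by simpa [W] using hxb⟩
    · refine Set.iUnion_subset fun s => Set.iUnion₂_subset fun b _ => b.2
  have hdir : Directed (· ⊆ ·) W := by
    classical
    intro s t
    exact ⟨s ∪ t, Set.biUnion_subset_biUnion_left fun b hb => Finset.mem_union_left _ hb,
      Set.biUnion_subset_biUnion_left fun b hb => Finset.mem_union_right _ hb⟩
  rw [hGW, hdir.measure_iUnion, lt_iSup_iff] at hc
  obtain ⟨s, hs⟩ := hc
  classical
  obtain ⟨k, hk⟩ := he (s.image Subtype.val)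
  have hUk : (⋃ b ∈ e k, (b : Set X)) = W s := by
    rw [hk]; ext x; simp [W]
  refine ⟨k, ?_, by simpa only [hUk] using hs⟩
  simp only [hUk]
  exact (Set.subset_iUnion W s).trans hGW.ge

/-- The integral of a nonnegative lower semicontinuous function is lower semicontinuous under weak
convergence of probability measures. -/
theorem lintegral_ofReal_le_liminf_of_tendsto {X : Type*} [TopologicalSpace X]
    [MeasurableSpace X] [OpensMeasurableSpace X] [HasOuterApproxClosed X]
    {μ : ProbabilityMeasure X} {μs : ℕ → ProbabilityMeasure X} (h : Tendsto μs atTop (𝓝 μ))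
    {f : X → ℝ} (hf : LowerSemicontinuous f) (hf0 : ∀ x, 0 ≤ f x) :
    ∫⁻ x, ENNReal.ofReal (f x) ∂(μ : Measure X) ≤
      atTop.liminf fun n => ∫⁻ x, ENNReal.ofReal (f x) ∂(μs n : Measure X) := by
  have hm : Measurable f := hf.measurable
  -- The layer-cake formula reduces the claim to the portmanteau inequality for the open superlevel
  -- sets; Fatou's lemma then moves the liminf outside.
  simp_rw [lintegral_eq_lintegral_meas_lt _ (Eventually.of_forall hf0) hm.aemeasurable]
  refine (lintegral_mono fun t => ProbabilityMeasure.le_liminf_measure_open_of_tendsto h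
    (hf.isOpen_preimage t)).trans ?_
  exact lintegral_liminf_le fun n => Antitone.measurable fun s t hst =>
    measure_mono fun ω hω => lt_of_le_of_lt hst hω

/-- A measurable map into a sequence space can be approximated, uniformly in finitely many
coordinates, by its composition with a map factoring through `ℕ`. -/
theorem exists_nat_factor_approx {Z E : Type*} [MeasurableSpace Z] [Nonempty Z]
    [PseudoMetricSpace E] [SecondCountableTopology E] [MeasurableSpace E] [OpensMeasurableSpace E]
    (F : ℕ → Z → E) (hF : ∀ k, Measurable (F k)) (n : ℕ) {δ : ℝ} (hδ : 0 < δ) :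
    ∃ (i : Z → ℕ) (r : ℕ → Z), Measurable i ∧ ∀ z, ∀ k < n, dist (F k (r (i z))) (F k z) < δ := by
  classical
  let G : Z → Fin n → E := fun z k => F k z
  have hG : Measurable G := measurable_pi_lambda _ fun k => hF k
  have hne : Nonempty (Fin n → E) := ⟨G (Classical.arbitrary Z)⟩
  let D := denseSeq (Fin n → E)
  have hex : ∀ z, ∃ N, dist (G z) (D N) < δ / 2 := fun z => by
    simpa using (denseRange_denseSeq (Fin n → E)).exists_dist_lt (G z) (half_pos hδ)
  -- `i z` is the first dense point within `δ / 2` of `G z`; `r N` is any parameter whose image is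
  -- that close to the same dense point.
  refine ⟨fun z => Nat.find (hex z), fun N =>
    if h : ∃ z, dist (G z) (D N) < δ / 2 then h.choose else Classical.arbitrary Z, ?_,
    fun z k hk => ?_⟩
  · exact measurable_find _ fun N => measurableSet_lt (hG.dist measurable_const) measurable_const
  · have h1 := Nat.find_spec (hex z)
    have h2 : ∃ z', dist (G z') (D (Nat.find (hex z))) < δ / 2 := ⟨z, h1⟩
    have h3 := h2.choose_spec
    simp only [dif_pos h2]
    have h4 : dist (G h2.choose) (G z) < δ := by
      have := dist_triangle_right (G h2.choose) (G z) (D (Nat.find (hex z)))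
      linarith
    exact lt_of_le_of_lt (dist_le_pi_dist (G h2.choose) (G z) ⟨k, hk⟩) h4

end WeakConvergence

/-! ### Couplings: mixtures and compactness -/

section Couplings

open Filter Topology

variable {X : Type*} [MeasurableSpace X]

theorem IsCoupling.isProbabilityMeasure {Γ : Measure (X × X)} {μ ν : Measure X}
    [IsProbabilityMeasure μ] (h : IsCoupling Γ μ ν) : IsProbabilityMeasure Γ := by
  constructor
  have := congrArg (fun m => m Set.univ) h.1
  simpa [Measure.map_apply measurable_fst] using this

theorem IsCoupling.prod (μ ν : Measure X) [IsProbabilityMeasure μ] [IsProbabilityMeasure ν] :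
    IsCoupling (μ.prod ν) μ ν := by
  constructor
  · rw [Measure.map_fst_prod]; simp
  · rw [Measure.map_snd_prod]; simp

theorem wassersteinSemimetric_le_of_isCoupling {c : X → X → ℝ} {Γ : Measure (X × X)}
    {μ ν : Measure X} (h : IsCoupling Γ μ ν) :
    wassersteinSemimetric c μ ν ≤ ∫⁻ p, ENNReal.ofReal (c p.1 p.2) ∂Γ :=
  iInf₂_le Γ h

theorem exists_isCoupling_lintegral_lt {c : X → X → ℝ} {μ ν : Measure X} {r : ℝ≥0∞}
    (h : wassersteinSemimetric c μ ν < r) :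
    ∃ Γ : Measure (X × X), IsCoupling Γ μ ν ∧ ∫⁻ p, ENNReal.ofReal (c p.1 p.2) ∂Γ < r := by
  simpa only [wassersteinSemimetric, iInf_lt_iff, exists_prop] using h

theorem wassersteinSemimetric_le_one {c : X → X → ℝ} (hc : ∀ x y, c x y ≤ 1) (μ ν : Measure X)
    [IsProbabilityMeasure μ] [IsProbabilityMeasure ν] : wassersteinSemimetric c μ ν ≤ 1 := by
  refine (wassersteinSemimetric_le_of_isCoupling (IsCoupling.prod μ ν)).trans ?_
  refine (lintegral_mono fun p : X × X => ENNReal.ofReal_le_one.2 (hc p.1 p.2)).trans ?_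
  simp

/-- Mixtures of couplings over a countable index set are couplings of the mixtures. -/
theorem IsCoupling.bind_nat (m : Measure ℕ) {π : ℕ → Measure (X × X)} {μ ν : ℕ → Measure X}
    (h : ∀ n, IsCoupling (π n) (μ n) (ν n)) : IsCoupling (m.bind π) (m.bind μ) (m.bind ν) := by
  have hmeas : ∀ {Y : Type _} [MeasurableSpace Y] (f : ℕ → Measure Y), AEMeasurable f m :=
    fun f => (measurable_from_top (f := f)).aemeasurable
  constructor
  · ext s hs
    rw [Measure.map_apply measurable_fst hs, Measure.bind_apply (measurable_fst hs) (hmeas _),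
      Measure.bind_apply hs (hmeas _)]
    refine lintegral_congr fun n => ?_
    rw [← (h n).1, Measure.map_apply measurable_fst hs]
  · ext s hs
    rw [Measure.map_apply measurable_snd hs, Measure.bind_apply (measurable_snd hs) (hmeas _),
      Measure.bind_apply hs (hmeas _)]
    refine lintegral_congr fun n => ?_
    rw [← (h n).2, Measure.map_apply measurable_snd hs]

variable [TopologicalSpace X] [PolishSpace X] [BorelSpace X]

/-- Sequential compactness of couplings: if the marginals converge weakly then, along a
subsequence, the couplings converge weakly to a coupling of the limits. -/
theorem exists_isCoupling_tendsto {μ ν : ProbabilityMeasure X} {μs νs : ℕ → ProbabilityMeasure X}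
    (hμ : Tendsto μs atTop (𝓝 μ)) (hν : Tendsto νs atTop (𝓝 ν))
    {π : ℕ → ProbabilityMeasure (X × X)}
    (hπ : ∀ n, IsCoupling (π n : Measure (X × X)) (μs n) (νs n)) :
    ∃ (ρ : ProbabilityMeasure (X × X)) (φ : ℕ → ℕ), StrictMono φ ∧
      IsCoupling (ρ : Measure (X × X)) μ ν ∧ Tendsto (π ∘ φ) atTop (𝓝 ρ) := by
  let _ := TopologicalSpace.upgradeIsCompletelyMetrizable X
  -- A convergent sequence is relatively compact, hence tight on a Polish space; tight marginals
  -- make the couplings tight.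
  have tight : ∀ {m : ProbabilityMeasure X} {ms : ℕ → ProbabilityMeasure X},
      Tendsto ms atTop (𝓝 m) →
      IsTightMeasureSet {((p : ProbabilityMeasure X) : Measure X) | p ∈ Set.range ms} := by
    intro m ms hm
    apply isTightMeasureSet_of_isCompact_closure
    refine hm.isCompact_insert_range.closure_of_subset (Set.subset_insert _ _)
  have hT : IsTightMeasureSet
      {((p : ProbabilityMeasure (X × X)) : Measure (X × X)) | p ∈ Set.range π} := by
    refine IsTightMeasureSet.prodMk ((tight hμ).subset ?_) ((tight hν).subset ?_)
    · rintro _ ⟨_, ⟨_, ⟨n, rfl⟩, rfl⟩, rfl⟩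
      exact ⟨μs n, ⟨n, rfl⟩, (hπ n).1.symm⟩
    · rintro _ ⟨_, ⟨_, ⟨n, rfl⟩, rfl⟩, rfl⟩
      exact ⟨νs n, ⟨n, rfl⟩, (hπ n).2.symm⟩
  obtain ⟨ρ, -, φ, hφ, hlim⟩ := (isCompact_closure_of_isTightMeasureSet hT).isSeqCompact
    (fun n => subset_closure (Set.mem_range_self n))
  refine ⟨ρ, φ, hφ, ⟨?_, ?_⟩, hlim⟩
  · have h1 := ProbabilityMeasure.tendsto_map_of_tendsto_of_continuous _ _ hlim continuous_fst
    have h2 : (fun n => ((π ∘ φ) n).map (continuous_fst (X := X) (Y := X)).measurable.aemeasurable)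
        = μs ∘ φ := by
      funext n
      apply ProbabilityMeasure.toMeasure_injective
      exact (hπ (φ n)).1
    rw [h2] at h1
    exact congrArg ProbabilityMeasure.toMeasure
      (tendsto_nhds_unique h1 (hμ.comp hφ.tendsto_atTop))
  · have h1 := ProbabilityMeasure.tendsto_map_of_tendsto_of_continuous _ _ hlim continuous_snd
    have h2 : (fun n => ((π ∘ φ) n).map (continuous_snd (X := X) (Y := X)).measurable.aemeasurable)
        = νs ∘ φ := by
      funext n
      apply ProbabilityMeasure.toMeasure_injective
      exact (hπ (φ n)).2
    rw [h2] at h1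
    exact congrArg ProbabilityMeasure.toMeasure
      (tendsto_nhds_unique h1 (hν.comp hφ.tendsto_atTop))

end Couplings

/-! ### Convexity of the Wasserstein semimetric -/

section Mixtures

open Filter Topology

/-- Weak convergence follows from one-sided approximation on a determining sequence of sets. -/
theorem tendsto_of_forall_le_add {X : Type*} [TopologicalSpace X] [MeasurableSpace X]
    [OpensMeasurableSpace X] {U : ℕ → Set X}
    (hU : ∀ (m : Measure X) (G : Set X), IsOpen G → ∀ c < m G, ∃ k, U k ⊆ G ∧ c < m (U k))
    {μ : ProbabilityMeasure X} {μs : ℕ → ProbabilityMeasure X} {δ : ℕ → ℝ}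
    (hδ : Tendsto δ atTop (𝓝 0))
    (h : ∀ n, ∀ k ≤ n,
      (μ : Measure X) (U k) ≤ (μs n : Measure X) (U k) + ENNReal.ofReal (δ n)) :
    Tendsto μs atTop (𝓝 μ) := by
  refine tendsto_of_forall_isOpen_le_liminf' fun G hG => le_of_forall_lt fun c hc => ?_
  obtain ⟨c', hcc', hc'⟩ := exists_between hc
  obtain ⟨k, hkG, hk⟩ := hU _ G hG c' hc'
  refine hcc'.trans_le (le_liminf_of_le (by isBoundedDefault) ?_)
  have hlim : Tendsto (fun n => c' + ENNReal.ofReal (δ n)) atTop (𝓝 (c' + 0)) := by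
    refine Tendsto.const_add c' ?_
    simpa [Function.comp_def] using (ENNReal.continuous_ofReal.tendsto 0).comp hδ
  rw [add_zero] at hlim
  filter_upwards [hlim.eventually_lt_const hk, eventually_ge_atTop k] with n hn hkn
  have h1 := hn.le.trans (h n k hkn)
  exact ((ENNReal.add_le_add_iff_right ENNReal.ofReal_ne_top).1 h1).trans (measure_mono hkG)

variable {X Z : Type*} [MeasurableSpace X] [TopologicalSpace X] [PolishSpace X] [BorelSpace X]
  [MeasurableSpace Z]

/-- Convexity of the Wasserstein semimetric with a lower semicontinuous cost: a pointwise bound on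
the distance between two Markov kernels integrates to a bound on the distance between mixtures. -/
theorem wassersteinSemimetric_bind_le (Γ : Measure Z) [IsProbabilityMeasure Γ] (κ η : Kernel Z X)
    [IsMarkovKernel κ] [IsMarkovKernel η] {c : X → X → ℝ} (hc0 : ∀ x y, 0 ≤ c x y)
    (hc : LowerSemicontinuous fun p : X × X => c p.1 p.2) {f : Z → ℝ} (hf : Measurable f)
    (h : ∀ z, wassersteinSemimetric c (κ z) (η z) ≤ ENNReal.ofReal (f z)) :
    wassersteinSemimetric c (Γ.bind κ) (Γ.bind η) ≤ ∫⁻ z, ENNReal.ofReal (f z) ∂Γ := by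
  have : Nonempty Z := Γ.nonempty_of_neZero
  obtain ⟨U, hUo, hU⟩ := exists_seq_isOpen_forall_lt_measure X
  let δ : ℕ → ℝ := fun n => 1 / ((n : ℝ) + 1)
  have hδ0 : ∀ n, 0 < δ n := fun n => Nat.one_div_pos_of_nat
  have hδ : Tendsto δ atTop (𝓝 0) := tendsto_one_div_add_atTop_nhds_zero_nat
  have hδ' : Tendsto (fun n => ENNReal.ofReal (δ n)) atTop (𝓝 0) := by
    simpa [Function.comp_def] using (ENNReal.continuous_ofReal.tendsto 0).comp hδ
  -- No measurability in `z` is required: only the countably many couplings at the points `r n m`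
  -- will be used.
  choose π hπ hπc using fun (n : ℕ) (z : Z) => exists_isCoupling_lintegral_lt
    ((h z).trans_lt (ENNReal.lt_add_right ENNReal.ofReal_ne_top
      (ENNReal.ofReal_pos.2 (hδ0 n)).ne'))
  let F : ℕ → Z → ℝ × ℝ × ℝ := fun k z => (f z, (κ z).real (U k), (η z).real (U k))
  have hF : ∀ k, Measurable (F k) := fun k => hf.prodMk
    ((κ.measurable_coe (hUo k).measurableSet).ennreal_toReal.prodMk
      (η.measurable_coe (hUo k).measurableSet).ennreal_toReal)
  -- `n + 1` coordinates cover all `k ≤ n`, so at least `k = 0`, which controls the bound `f`.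
  choose i r hi hr using fun n : ℕ => exists_nat_factor_approx F hF (n + 1) (hδ0 n)
  have hnat : ∀ {Y : Type _} [MeasurableSpace Y] (g : ℕ → Measure Y) (m : Measure ℕ),
    AEMeasurable g m := fun g m => (measurable_from_top (f := g)).aemeasurable
  have hprobi : ∀ n, IsProbabilityMeasure (Γ.map (i n)) := fun n =>
    Measure.isProbabilityMeasure_map (hi n).aemeasurable
  have hmarg : ∀ (ζ : Kernel Z X) [IsMarkovKernel ζ],
      (∀ n z, ∀ k ≤ n, |(ζ (r n (i n z))).real (U k) - (ζ z).real (U k)| < δ n) →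
      ∃ (μ : ProbabilityMeasure X) (μs : ℕ → ProbabilityMeasure X),
        (μ : Measure X) = Γ.bind ζ ∧
        (∀ n, (μs n : Measure X) = (Γ.map (i n)).bind fun m => ζ (r n m)) ∧
        Tendsto μs atTop (𝓝 μ) := by
    intro ζ _ hζ
    refine ⟨⟨Γ.bind ζ, isProbabilityMeasure_bind ζ.measurable.aemeasurable
        (Eventually.of_forall fun z => inferInstance)⟩,
      fun n => ⟨(Γ.map (i n)).bind fun m => ζ (r n m), isProbabilityMeasure_bind (hnat _ _)
        (Eventually.of_forall fun z => inferInstance)⟩, rfl, fun n => rfl, ?_⟩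
    refine tendsto_of_forall_le_add hU hδ fun n k hk => ?_
    have hUm := (hUo k).measurableSet
    simp only [ProbabilityMeasure.coe_mk]
    rw [Measure.bind_apply hUm ζ.measurable.aemeasurable, Measure.bind_apply hUm (hnat _ _),
      lintegral_map measurable_from_top (hi n)]
    calc ∫⁻ z, ζ z (U k) ∂Γ ≤ ∫⁻ z, (ζ (r n (i n z)) (U k) + ENNReal.ofReal (δ n)) ∂Γ := by
          refine lintegral_mono fun z => ?_
          have h1 := (abs_lt.1 (hζ n z k hk)).1
          rw [← ENNReal.ofReal_toReal (measure_ne_top (ζ z) (U k)),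
            ← ENNReal.ofReal_toReal (measure_ne_top (ζ (r n (i n z))) (U k)),
            ← ENNReal.ofReal_add ENNReal.toReal_nonneg (hδ0 n).le]
          apply ENNReal.ofReal_le_ofReal
          simp only [Measure.real] at h1
          linarith
      _ = _ := by rw [lintegral_add_right _ measurable_const]; simp
  have hdist : ∀ n z, ∀ k ≤ n, |f (r n (i n z)) - f z| < δ n ∧
      |(κ (r n (i n z))).real (U k) - (κ z).real (U k)| < δ n ∧
      |(η (r n (i n z))).real (U k) - (η z).real (U k)| < δ n := by
    intro n z k hk
    have := hr n z k (Nat.lt_succ_of_le hk)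
    simpa only [F, Prod.dist_eq, max_lt_iff, Real.dist_eq] using this
  obtain ⟨μ, μs, hμ, hμs, hμlim⟩ := hmarg κ fun n z k hk => (hdist n z k hk).2.1
  obtain ⟨ν, νs, hν, hνs, hνlim⟩ := hmarg η fun n z k hk => (hdist n z k hk).2.2
  have hcoup : ∀ n, IsCoupling ((Γ.map (i n)).bind fun m => π n (r n m)) (μs n : Measure X)
      (νs n : Measure X) := fun n => by
    rw [hμs, hνs]; exact IsCoupling.bind_nat _ fun m => hπ n (r n m)
  let π' : ℕ → ProbabilityMeasure (X × X) := fun n => ⟨_, (hcoup n).isProbabilityMeasure⟩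
  obtain ⟨ρ, φ, hφ, hρ, hlim⟩ := exists_isCoupling_tendsto hμlim hνlim (π := π') hcoup
  rw [hμ, hν] at hρ
  refine (wassersteinSemimetric_le_of_isCoupling hρ).trans ?_
  refine (lintegral_ofReal_le_liminf_of_tendsto hlim hc fun p => hc0 p.1 p.2).trans ?_
  -- One `δ n` pays for near-optimality of the coupling, the other for replacing `f (r n (i n z))`
  -- by `f z`.
  have hcost : ∀ n, ∫⁻ p, ENNReal.ofReal (c p.1 p.2) ∂(π' n : Measure (X × X)) ≤
      ∫⁻ z, ENNReal.ofReal (f z) ∂Γ + (ENNReal.ofReal (δ n) + ENNReal.ofReal (δ n)) := by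
    intro n
    change ∫⁻ p, ENNReal.ofReal (c p.1 p.2) ∂((Γ.map (i n)).bind fun m => π n (r n m)) ≤ _
    rw [Measure.lintegral_bind (hnat _ _) hc.measurable.ennreal_ofReal.aemeasurable,
      lintegral_map measurable_from_top (hi n)]
    calc _ ≤ ∫⁻ z, (ENNReal.ofReal (f z) + (ENNReal.ofReal (δ n) + ENNReal.ofReal (δ n))) ∂Γ := by
          refine lintegral_mono fun z => (hπc n (r n (i n z))).le.trans ?_
          rw [← add_assoc]
          gcongr
          refine (ENNReal.ofReal_le_ofReal ?_).trans ENNReal.ofReal_add_le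
          have := (abs_lt.1 (hdist n z 0 (Nat.zero_le n)).1).2
          linarith
      _ = _ := by rw [lintegral_add_right _ measurable_const]; simp
  have htend : Tendsto (fun n => ∫⁻ z, ENNReal.ofReal (f z) ∂Γ +
      (ENNReal.ofReal (δ (φ n)) + ENNReal.ofReal (δ (φ n)))) atTop
      (𝓝 (∫⁻ z, ENNReal.ofReal (f z) ∂Γ + (0 + 0))) :=
    ((hδ'.add hδ').comp hφ.tendsto_atTop).const_add _
  rw [add_zero, add_zero] at htend
  rw [← htend.liminf_eq]
  exact liminf_le_liminf (Eventually.of_forall fun n => hcost (φ n))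

/-- A kernel whose transition probabilities satisfy `W_c (Q x) (Q y) ≤ q f(x, y)` satisfies
`W_c (Q μ) (Q ν) ≤ q W_f(μ, ν)`. -/
theorem wassersteinSemimetric_bind_le_mul (Q : Kernel X X) [IsMarkovKernel Q] {c f : X → X → ℝ}
    (hc0 : ∀ x y, 0 ≤ c x y) (hc : LowerSemicontinuous fun p : X × X => c p.1 p.2)
    (hf : Measurable fun p : X × X => f p.1 p.2) {q : ℝ} (hq : 0 < q)
    (h : ∀ x y, wassersteinSemimetric c (Q x) (Q y) ≤ ENNReal.ofReal (q * f x y))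
    (μ ν : Measure X) [IsProbabilityMeasure μ] :
    wassersteinSemimetric c (μ.bind Q) (ν.bind Q) ≤
      ENNReal.ofReal q * wassersteinSemimetric f μ ν := by
  have hq0 : ENNReal.ofReal q ≠ 0 := (ENNReal.ofReal_pos.2 hq).ne'
  conv_rhs => rw [wassersteinSemimetric, ENNReal.mul_iInf_of_ne hq0 ENNReal.ofReal_ne_top]
  refine le_iInf fun Γ => ?_
  rw [ENNReal.mul_iInf_of_ne hq0 ENNReal.ofReal_ne_top]
  refine le_iInf fun hΓ => ?_
  have := hΓ.isProbabilityMeasure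
  have hbind : ∀ {g : X × X → X} (hg : Measurable g), Γ.bind (Q.comap g hg) = (Γ.map g).bind Q :=
    fun hg => by rw [Measure.bind, Measure.bind, Measure.map_map Q.measurable hg]; rfl
  have key := wassersteinSemimetric_bind_le Γ (Q.comap Prod.fst measurable_fst)
    (Q.comap Prod.snd measurable_snd) hc0 hc (f := fun p => q * f p.1 p.2) (hf.const_mul q)
    fun p => h p.1 p.2
  rw [hbind, hbind, hΓ.1, hΓ.2] at key
  refine key.trans_eq ?_
  rw [← lintegral_const_mul _ hf.ennreal_ofReal]
  exact lintegral_congr fun p => ENNReal.ofReal_mul hq.le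

end Mixtures

/-! ### The weighted semimetric and the one-step contraction -/

section WeightedSemimetric

open Filter Topology

theorem weightedSemimetric_nonneg {X : Type*} (d : X → X → ℝ) (V : X → ℝ) (x y : X) :
    0 ≤ weightedSemimetric d V x y :=
  Real.sqrt_nonneg _

/-- For `y ≥ 0`, the cost exceeds `y` exactly where `d - y² / (1 + V + V)` is positive, and this is
a lower semicontinuous function plus a continuous one. -/
theorem lowerSemicontinuous_weightedSemimetric {X : Type*} [TopologicalSpace X] {d : X → X → ℝ}
    (hd : LowerSemicontinuous fun p : X × X => d p.1 p.2) {V : X → ℝ} (hV : Continuous V)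
    (hV0 : ∀ x, 0 ≤ V x) :
    LowerSemicontinuous fun p : X × X => weightedSemimetric d V p.1 p.2 := by
  rw [lowerSemicontinuous_iff_isOpen_preimage]
  intro y
  rcases lt_or_ge y 0 with hy | hy
  · convert isOpen_univ
    exact Set.eq_univ_of_forall fun p => hy.trans_le (weightedSemimetric_nonneg d V p.1 p.2)
  · have hpos : ∀ p : X × X, 0 < 1 + V p.1 + V p.2 := fun p => by
      linarith [hV0 p.1, hV0 p.2]
    have hcont : Continuous fun p : X × X => -(y ^ 2 / (1 + V p.1 + V p.2)) :=
      (continuous_const.div (by fun_prop) fun p => (hpos p).ne').neg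
    have hlsc := hd.add hcont.lowerSemicontinuous
    convert hlsc.isOpen_preimage 0 using 1
    ext p
    simp only [Set.mem_preimage, Set.mem_Ioi, weightedSemimetric, Real.lt_sqrt hy]
    rw [← sub_eq_add_neg, sub_pos, div_lt_iff₀ (hpos p)]

variable {X : Type*} [MeasurableSpace X]

/-- Cauchy–Schwarz; the second factor depends on the coupling only through its marginals. -/
theorem lintegral_weightedSemimetric_le {d : X → X → ℝ} (hd0 : ∀ x y, 0 ≤ d x y)
    (hd : Measurable fun p : X × X => d p.1 p.2) {V : X → ℝ} (hV : Measurable V)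
    (hV0 : ∀ x, 0 ≤ V x) {μ ν : Measure X} [IsProbabilityMeasure μ] {Γ : Measure (X × X)}
    (hΓ : IsCoupling Γ μ ν) :
    ∫⁻ p, ENNReal.ofReal (weightedSemimetric d V p.1 p.2) ∂Γ ≤
      (∫⁻ p, ENNReal.ofReal (d p.1 p.2) ∂Γ) ^ (1 / 2 : ℝ) *
      (1 + ∫⁻ x, ENNReal.ofReal (V x) ∂μ + ∫⁻ x, ENNReal.ofReal (V x) ∂ν) ^ (1 / 2 : ℝ) := by
  have := hΓ.isProbabilityMeasure
  have hV1 : Measurable fun p : X × X => ENNReal.ofReal (V p.1) :=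
    (hV.comp measurable_fst).ennreal_ofReal
  have hV2 : Measurable fun p : X × X => ENNReal.ofReal (V p.2) :=
    (hV.comp measurable_snd).ennreal_ofReal
  have hsq : ∀ a : ℝ≥0∞, (a ^ (1 / 2 : ℝ)) ^ (2 : ℝ) = a := fun a => by
    rw [← ENNReal.rpow_mul]; norm_num
  have h := ENNReal.lintegral_mul_le_Lp_mul_Lq Γ Real.HolderConjugate.two_two
    (f := fun p => ENNReal.ofReal (d p.1 p.2) ^ (1 / 2 : ℝ))
    (g := fun p => (1 + ENNReal.ofReal (V p.1) + ENNReal.ofReal (V p.2)) ^ (1 / 2 : ℝ))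
    (hd.ennreal_ofReal.pow_const _).aemeasurable
    (((measurable_const.add hV1).add hV2).pow_const _).aemeasurable
  simp only [hsq] at h
  rw [lintegral_add_right _ hV2, lintegral_add_right _ hV1, lintegral_const, measure_univ, mul_one,
    ← lintegral_map (f := fun x => ENNReal.ofReal (V x)) hV.ennreal_ofReal measurable_fst,
    ← lintegral_map (f := fun x => ENNReal.ofReal (V x)) hV.ennreal_ofReal measurable_snd,
    hΓ.1, hΓ.2] at h
  refine (lintegral_congr fun p => ?_).trans_le h
  have h1 : (0 : ℝ) ≤ 1 + V p.1 + V p.2 := by linarith [hV0 p.1, hV0 p.2]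
  rw [Pi.mul_apply, weightedSemimetric, ← ENNReal.mul_rpow_of_nonneg _ _ (by norm_num),
    ← ENNReal.ofReal_one, ← ENNReal.ofReal_add zero_le_one (hV0 _),
    ← ENNReal.ofReal_add (by linarith [hV0 p.1]) (hV0 _), ← ENNReal.ofReal_mul (hd0 _ _),
    ENNReal.ofReal_rpow_of_nonneg (mul_nonneg (hd0 _ _) h1) (by norm_num), Real.sqrt_eq_rpow]

/-- Since the moment factor is the same for all couplings, one may take couplings nearly optimal for
`d` alone and let the excess `1 / (n + 1)` tend to zero. -/
theorem wassersteinSemimetric_weightedSemimetric_le {d : X → X → ℝ} (hd0 : ∀ x y, 0 ≤ d x y)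
    (hd : Measurable fun p : X × X => d p.1 p.2) {V : X → ℝ} (hV : Measurable V)
    (hV0 : ∀ x, 0 ≤ V x) {μ ν : Measure X} [IsProbabilityMeasure μ] {A B : ℝ} (hA : 0 ≤ A)
    (hB : 0 ≤ B) (hAW : wassersteinSemimetric d μ ν ≤ ENNReal.ofReal A)
    (hBV : 1 + ∫⁻ x, ENNReal.ofReal (V x) ∂μ + ∫⁻ x, ENNReal.ofReal (V x) ∂ν ≤
      ENNReal.ofReal B) :
    wassersteinSemimetric (weightedSemimetric d V) μ ν ≤ ENNReal.ofReal (Real.sqrt (A * B)) := by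
  have key : ∀ n : ℕ, wassersteinSemimetric (weightedSemimetric d V) μ ν ≤
      ENNReal.ofReal (Real.sqrt ((A + 1 / ((n : ℝ) + 1)) * B)) := fun n => by
    have hδ : (0 : ℝ) < 1 / ((n : ℝ) + 1) := Nat.one_div_pos_of_nat
    obtain ⟨Γ, hΓ, hlt⟩ := exists_isCoupling_lintegral_lt (hAW.trans_lt
      ((ENNReal.ofReal_lt_ofReal_iff (by linarith)).2 (lt_add_of_pos_right A hδ)))
    refine (wassersteinSemimetric_le_of_isCoupling hΓ).trans
      ((lintegral_weightedSemimetric_le hd0 hd hV hV0 hΓ).trans ?_)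
    have hmul : (0 : ℝ) ≤ (A + 1 / ((n : ℝ) + 1)) * B := mul_nonneg (by linarith) hB
    rw [Real.sqrt_eq_rpow, ← ENNReal.ofReal_rpow_of_nonneg hmul (by norm_num),
      ENNReal.ofReal_mul (by linarith), ENNReal.mul_rpow_of_nonneg _ _ (by norm_num)]
    gcongr
  refine ge_of_tendsto' (x := atTop) ?_ key
  refine (ENNReal.continuous_ofReal.tendsto _).comp ((Real.continuous_sqrt.tendsto _).comp ?_)
  simpa using (tendsto_one_div_add_atTop_nhds_zero_nat.const_add A).mul_const B

/-- One step of the weak Harris theorem: under a Lyapunov condition, contraction and smallness, a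
Markov kernel contracts the semimetric `√(d(x, y) (1 + β V(x) + β V(y)))`, with constants
depending only on those of the assumptions. -/
theorem exists_weightedSemimetric_contraction {d : X → X → ℝ} (hd0 : ∀ x y, 0 ≤ d x y)
    (hd1 : ∀ x y, d x y ≤ 1) (hd : Measurable fun p : X × X => d p.1 p.2) {V : X → ℝ}
    (hV : Measurable V) (hV0 : ∀ x, 0 ≤ V x) {K α ε : ℝ} (hK : 0 < K) (hα : α < 1)
    (hα0 : 0 ≤ α) (hε : 0 < ε) (hε1 : ε ≤ 1) :
    ∃ β q : ℝ, 0 < β ∧ β ≤ 1 ∧ 0 < q ∧ q < 1 ∧ ∀ (Q : Kernel X X) [IsMarkovKernel Q],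
      (∀ x, ∫⁻ y, ENNReal.ofReal (V y) ∂(Q x) ≤ ENNReal.ofReal (V x / 4 + K)) →
      (∀ x y, d x y < 1 → wassersteinSemimetric d (Q x) (Q y) ≤ ENNReal.ofReal (α * d x y)) →
      (∀ x y, V x ≤ 4 * K → V y ≤ 4 * K →
        wassersteinSemimetric d (Q x) (Q y) ≤ ENNReal.ofReal (1 - ε)) →
      ∀ x y, wassersteinSemimetric (weightedSemimetric d fun x => β * V x) (Q x) (Q y) ≤
        ENNReal.ofReal (q * weightedSemimetric d (fun x => β * V x) x y) := by
  obtain ⟨m, hm0, hm1, hαm, hεm⟩ : ∃ m : ℝ, 0 ≤ m ∧ m < 1 ∧ α ≤ m ∧ 1 - ε ≤ m :=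
    ⟨max α (1 - ε), hα0.trans (le_max_left _ _), max_lt hα (by linarith), le_max_left _ _,
      le_max_right _ _⟩
  obtain ⟨β, hβ0, hβ1, hβ⟩ : ∃ β : ℝ, 0 < β ∧ β ≤ 1 ∧ 4 * (β * K) ≤ 1 - m := by
    refine ⟨min 1 ((1 - m) / (4 * K)), lt_min one_pos (div_pos (by linarith) (by linarith)),
      min_le_left _ _, ?_⟩
    have := (le_div_iff₀ (by linarith)).1 (min_le_right 1 ((1 - m) / (4 * K)))
    linarith
  have hβK : 0 < β * K := mul_pos hβ0 hK
  -- The first inequality serves the contracting and small cases. The second is the far case at its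
  -- worst point `V x + V y = 4K`; beyond it, slope `q ≥ 1/4` suffices.
  obtain ⟨q, hq0, hq1, hmq, hKq⟩ : ∃ q : ℝ, 0 < q ∧ q < 1 ∧ m * (1 + 2 * (β * K)) ≤ q ∧
      1 + 3 * (β * K) ≤ q * (1 + 4 * (β * K)) := by
    refine ⟨max ((1 + m) / 2) ((1 + 3 * (β * K)) / (1 + 4 * (β * K))),
      lt_max_of_lt_left (by linarith), max_lt (by linarith) ?_, le_max_of_le_left ?_, ?_⟩
    · rw [div_lt_one (by linarith)]; linarith
    · nlinarith
    · exact (div_le_iff₀ (by linarith)).1 (le_max_right _ _)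
  have hβV : Measurable fun x => β * V x := hV.const_mul β
  refine ⟨β, Real.sqrt q, hβ0, hβ1, Real.sqrt_pos.2 hq0, by
    rw [Real.sqrt_lt' one_pos]; linarith, fun Q _ hL hC hS x y => ?_⟩
  have hx := hV0 x
  have hy := hV0 y
  have hxy : 0 ≤ β * (V x + V y) := by positivity
  -- The squared inequality suffices, which is why the contraction constant is `√q`.
  suffices h : ∃ A : ℝ, 0 ≤ A ∧ wassersteinSemimetric d (Q x) (Q y) ≤ ENNReal.ofReal A ∧
      A * (1 + 2 * (β * K) + β * (V x + V y) / 4) ≤ q * (d x y * (1 + β * (V x + V y))) by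
    obtain ⟨A, hA0, hA, hAB⟩ := h
    have hB : 1 + ∫⁻ z, ENNReal.ofReal (β * V z) ∂(Q x) + ∫⁻ z, ENNReal.ofReal (β * V z) ∂(Q y) ≤
        ENNReal.ofReal (1 + 2 * (β * K) + β * (V x + V y) / 4) := by
      have hint : ∀ z, ∫⁻ w, ENNReal.ofReal (β * V w) ∂(Q z) ≤
          ENNReal.ofReal (β * (V z / 4 + K)) := fun z => by
        simp only [ENNReal.ofReal_mul hβ0.le]
        rw [lintegral_const_mul _ hV.ennreal_ofReal]
        gcongr
        exact hL z
      have hx' : 0 ≤ β * (V x / 4 + K) := by positivity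
      have hy' : 0 ≤ β * (V y / 4 + K) := by positivity
      calc _ ≤ ENNReal.ofReal 1 + ENNReal.ofReal (β * (V x / 4 + K)) +
            ENNReal.ofReal (β * (V y / 4 + K)) := by
              rw [ENNReal.ofReal_one]; gcongr <;> exact hint _
        _ = ENNReal.ofReal (1 + 2 * (β * K) + β * (V x + V y) / 4) := by
          rw [← ENNReal.ofReal_add zero_le_one hx', ← ENNReal.ofReal_add (by linarith) hy']
          congr 1; ring
    refine (wassersteinSemimetric_weightedSemimetric_le hd0 hd hβV
      (fun x => mul_nonneg hβ0.le (hV0 x)) hA0 (by positivity) hA hB).trans ?_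
    rw [weightedSemimetric, ← Real.sqrt_mul hq0.le]
    refine ENNReal.ofReal_le_ofReal (Real.sqrt_le_sqrt (hAB.trans_eq ?_))
    ring
  rcases (hd1 x y).lt_or_eq with hlt | heq
  · refine ⟨α * d x y, mul_nonneg hα0 (hd0 x y), hC x y hlt, ?_⟩
    have h1 : α * (1 + 2 * (β * K) + β * (V x + V y) / 4) ≤ q * (1 + β * (V x + V y)) := by
      have h2 : α * (1 + 2 * (β * K)) ≤ q := (by gcongr : _ ≤ m * (1 + 2 * (β * K))).trans hmq
      have h3 : α ≤ q := by nlinarith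
      nlinarith
    nlinarith [mul_le_mul_of_nonneg_left h1 (hd0 x y)]
  · rw [heq]
    -- Far out, the trivial bound `W_d ≤ 1` is enough; otherwise nonnegativity of `V` puts both
    -- points in the small set.
    by_cases hsum : 4 * K ≤ V x + V y
    · refine ⟨1, zero_le_one, by simpa using wassersteinSemimetric_le_one hd1 (Q x) (Q y), ?_⟩
      have h4 : 4 * (β * K) ≤ β * (V x + V y) := by nlinarith
      have h5 : 1 / 4 ≤ q := by nlinarith
      nlinarith
    · push Not at hsum
      refine ⟨1 - ε, by linarith, hS x y (by linarith) (by linarith), ?_⟩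
      have h2 : (1 - ε) * (1 + 2 * (β * K)) ≤ q := (by gcongr : _ ≤ m * (1 + 2 * (β * K))).trans hmq
      have h3 : 1 - ε ≤ q := by nlinarith
      nlinarith

end WeightedSemimetric

/-! ### Semigroups: invariant moments and iteration in time -/

section Semigroup

open Filter Topology

theorem wassersteinSemimetric_le_mul {X : Type*} [MeasurableSpace X] {c c' : X → X → ℝ} {k : ℝ}
    (hk : 0 < k) (h : ∀ x y, c x y ≤ k * c' x y) (μ ν : Measure X) :
    wassersteinSemimetric c μ ν ≤ ENNReal.ofReal k * wassersteinSemimetric c' μ ν := by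
  have hk0 : ENNReal.ofReal k ≠ 0 := (ENNReal.ofReal_pos.2 hk).ne'
  conv_rhs => rw [wassersteinSemimetric, ENNReal.mul_iInf_of_ne hk0 ENNReal.ofReal_ne_top]
  refine le_iInf fun Γ => ?_
  rw [ENNReal.mul_iInf_of_ne hk0 ENNReal.ofReal_ne_top]
  refine le_iInf fun hΓ => (wassersteinSemimetric_le_of_isCoupling hΓ).trans ?_
  rw [← lintegral_const_mul' _ _ ENNReal.ofReal_ne_top]
  refine lintegral_mono fun p : X × X => ?_
  rw [← ENNReal.ofReal_mul hk.le]
  exact ENNReal.ofReal_le_ofReal (h p.1 p.2)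

theorem IsMarkovSemigroup.bind_add {X : Type*} [MeasurableSpace X] {P : ℝ≥0 → Kernel X X}
    (hP : IsMarkovSemigroup P) (μ : Measure X) (s t : ℝ≥0) :
    μ.bind (P (s + t)) = (μ.bind (P s)).bind (P t) := by
  rw [hP.add, Measure.bind_bind (P s).measurable.aemeasurable (P t).measurable.aemeasurable]
  rfl

/-- An invariant probability measure of a semigroup with a Lyapunov function has finite `V`-moment,
bounded by the constant term of the Lyapunov condition. -/
theorem IsLyapunovFunction.lintegral_le_of_invariant {X : Type*} [MeasurableSpace X]
    {P : ℝ≥0 → Kernel X X} (hP : IsMarkovSemigroup P) {V : X → ℝ} {C κ K : ℝ}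
    (hV : IsLyapunovFunction P V C κ K) {μ : Measure X} [IsProbabilityMeasure μ]
    (hμ : ∀ t, (P t).Invariant μ) : ∫⁻ x, ENNReal.ofReal (V x) ∂μ ≤ ENNReal.ofReal K := by
  have hVm : Measurable fun x => ENNReal.ofReal (V x) := hV.measurable.ennreal_ofReal
  -- `V` is not known to be `μ`-integrable, so it is truncated at `M`; dominated convergence in time
  -- then removes the term `C e^{-κn} V`.
  have htrunc : ∀ M : ℕ, ∫⁻ x, min (ENNReal.ofReal (V x)) M ∂μ ≤ ENNReal.ofReal K := by
    intro M
    have hbound : ∀ n : ℕ, ∫⁻ x, min (ENNReal.ofReal (V x)) M ∂μ ≤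
        ∫⁻ x, min (ENNReal.ofReal (C * Real.exp (-κ * (n : ℝ)) * V x + K)) M ∂μ := by
      intro n
      have := hP.markov n
      conv_lhs => rw [← (hμ n).def]
      rw [Measure.lintegral_bind (P n).measurable.aemeasurable
        (hVm.min measurable_const).aemeasurable]
      refine lintegral_mono fun x => le_min ?_ ?_
      · refine (lintegral_mono fun y => min_le_left _ _).trans ?_
        simpa using hV.bound n x
      · refine (lintegral_mono fun y => min_le_right _ _).trans ?_
        simp
    have hexp : Tendsto (fun n : ℕ => Real.exp (-κ * (n : ℝ))) atTop (𝓝 0) := by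
      refine Real.tendsto_exp_atBot.comp ?_
      exact tendsto_natCast_atTop_atTop.const_mul_atTop_of_neg (neg_neg_of_pos hV.κ_pos)
    have hlim : Tendsto (fun n : ℕ =>
        ∫⁻ x, min (ENNReal.ofReal (C * Real.exp (-κ * (n : ℝ)) * V x + K)) M ∂μ) atTop
        (𝓝 (∫⁻ _, min (ENNReal.ofReal K) M ∂μ)) := by
      refine tendsto_lintegral_of_dominated_convergence (fun _ => (M : ℝ≥0∞)) (fun n => ?_)
        (fun n => Eventually.of_forall fun x => min_le_right _ _) (by simp)
        (Eventually.of_forall fun x => ?_)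
      · exact ((hV.measurable.const_mul _).add_const _).ennreal_ofReal.min measurable_const
      · refine Tendsto.min ?_ tendsto_const_nhds
        refine (ENNReal.continuous_ofReal.tendsto K).comp ?_
        simpa using ((hexp.const_mul C).mul_const (V x)).add_const K
    refine (ge_of_tendsto' hlim hbound).trans ?_
    simp
  have hsup : ∀ x, ENNReal.ofReal (V x) = ⨆ M : ℕ, min (ENNReal.ofReal (V x)) (M : ℝ≥0∞) :=
    fun x => by rw [← inf_iSup_eq, ENNReal.iSup_natCast, inf_top_eq]
  calc ∫⁻ x, ENNReal.ofReal (V x) ∂μ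
      = ∫⁻ x, ⨆ M : ℕ, min (ENNReal.ofReal (V x)) (M : ℝ≥0∞) ∂μ := lintegral_congr hsup
    _ = ⨆ M : ℕ, ∫⁻ x, min (ENNReal.ofReal (V x)) (M : ℝ≥0∞) ∂μ :=
      lintegral_iSup (fun M => hVm.min measurable_const) fun M N hMN x =>
        min_le_min_left _ (by exact_mod_cast hMN)
    _ ≤ ENNReal.ofReal K := iSup_le htrunc

/-- The dilates `((n + 1) a, (n + 1) b)` overlap once `n` is large, hence cover a half-line. -/
theorem exists_pos_forall_ge_mem_nsmul_Ioo {a b : ℝ≥0} (hab : a < b) :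
    ∃ t₁ : ℝ≥0, 0 < t₁ ∧ ∀ t ≥ t₁, ∃ (n : ℕ) (T : ℝ≥0), T ∈ Set.Ioo a b ∧ t = (n + 1) • T := by
  have hb : 0 < b := (zero_le).trans_lt hab
  have hba : (0 : ℝ) < b - a := sub_pos.2 (NNReal.coe_lt_coe.2 hab)
  -- With `⌊t / b⌋ + 1` pieces, each is shorter than `b`; they exceed `a` when `a (t / b + 1) < t`,
  -- i.e. `t > ab / (b - a)`. The `+ 1` makes this strict.
  refine ⟨a * b / (b - a) + 1, by positivity, fun t ht => ?_⟩
  refine ⟨⌊t / b⌋₊, t / ((⌊t / b⌋₊ + 1 : ℕ) : ℝ≥0), ⟨?_, ?_⟩, ?_⟩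
  · rw [lt_div_iff₀ (by positivity), ← NNReal.coe_lt_coe]
    have h1 : ((⌊t / b⌋₊ : ℝ≥0) : ℝ) ≤ t / b := by
      exact_mod_cast Nat.floor_le (zero_le (a := t / b))
    have h2 : (a : ℝ) * b / (b - a) + 1 ≤ t := by
      have := NNReal.coe_le_coe.2 ht
      rwa [NNReal.coe_add, NNReal.coe_div, NNReal.coe_sub hab.le] at this
    have h3 : (a : ℝ) * b < t * (b - a) := by
      rw [← div_lt_iff₀ hba]; linarith
    have hb' : (0 : ℝ) < b := hb
    have h4 : (a : ℝ) * (t / b + 1) < t := by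
      rw [← sub_pos]
      have : (t : ℝ) - a * (t / b + 1) = (t * (b - a) - a * b) / b := by field_simp; ring
      rw [this]
      exact div_pos (by linarith) hb'
    push_cast
    have := mul_le_mul_of_nonneg_left (add_le_add_left h1 1) a.coe_nonneg
    refine lt_of_le_of_lt ?_ h4
    simpa using this
  · rw [div_lt_iff₀ (by positivity)]
    have := Nat.lt_floor_add_one (t / b)
    rw [div_lt_iff₀ hb] at this
    push_cast
    rwa [mul_comm]
  · rw [nsmul_eq_mul]
    exact (mul_div_cancel₀ _ (by positivity)).symm

variable {X : Type*} [MeasurableSpace X] [TopologicalSpace X] [PolishSpace X] [BorelSpace X]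
  {P : ℝ≥0 → Kernel X X}

theorem IsMarkovSemigroup.wassersteinSemimetric_bind_nsmul_le (hP : IsMarkovSemigroup P)
    {c : X → X → ℝ} (hc0 : ∀ x y, 0 ≤ c x y)
    (hc : LowerSemicontinuous fun p : X × X => c p.1 p.2) {q : ℝ} (hq : 0 < q) {s : ℝ≥0}
    (h : ∀ x y, wassersteinSemimetric c (P s x) (P s y) ≤ ENNReal.ofReal (q * c x y))
    (μ ν : Measure X) [IsProbabilityMeasure μ] (n : ℕ) :
    wassersteinSemimetric c (μ.bind (P (n • s))) (ν.bind (P (n • s))) ≤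
      ENNReal.ofReal (q ^ n) * wassersteinSemimetric c μ ν := by
  induction n with
  | zero => simp [hP.zero, Kernel.id, Kernel.deterministic]
  | succ n ih =>
    have := hP.markov s
    have := hP.markov (n • s)
    have : IsProbabilityMeasure (μ.bind (P (n • s))) :=
      isProbabilityMeasure_bind (P (n • s)).measurable.aemeasurable
        (Eventually.of_forall fun x => inferInstance)
    rw [succ_nsmul, hP.bind_add, hP.bind_add, pow_succ', ENNReal.ofReal_mul hq.le, mul_assoc]
    refine (wassersteinSemimetric_bind_le_mul (P s) hc0 hc hc.measurable hq h _ _).trans ?_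
    gcongr

/-- The further `n` steps are nonexpansive, so contraction and smallness at time `T` carry over to
its multiples with the same constants. -/
theorem IsMarkovSemigroup.wassersteinSemimetric_nsmul_le (hP : IsMarkovSemigroup P)
    {c : X → X → ℝ} (hc0 : ∀ x y, 0 ≤ c x y)
    (hc : LowerSemicontinuous fun p : X × X => c p.1 p.2) {T : ℝ≥0}
    (h : ∀ x y, wassersteinSemimetric c (P T x) (P T y) ≤ ENNReal.ofReal (c x y))
    (n : ℕ) (x y : X) :
    wassersteinSemimetric c (P ((n + 1) • T) x) (P ((n + 1) • T) y) ≤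
      wassersteinSemimetric c (P T x) (P T y) := by
  have := hP.markov T
  have key := hP.wassersteinSemimetric_bind_nsmul_le hc0 hc one_pos (by simpa using h)
    (P T x) (P T y) n
  rw [one_pow, ENNReal.ofReal_one, one_mul] at key
  rw [succ_nsmul', hP.add]
  exact key

end Semigroup

/-! ### The exponential contraction theorem -/

theorem corollary3p2 {H : Type*} [NormedAddCommGroup H] [InnerProductSpace ℝ H] [CompleteSpace H]
    [TopologicalSpace.SeparableSpace H] [MeasurableSpace H] [BorelSpace H]
    (P : ℝ≥0 → Kernel H H) (hP : IsMarkovSemigroup P)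
    (V : H → ℝ) (hVcont : Continuous V)
    (C_V γ_V K_V : ℝ) (hV : IsLyapunovFunction P V C_V γ_V K_V)
    (d : H → H → ℝ) (hd : IsSemimetric d) (hd1 : ∀ x y, d x y ≤ 1)
    (a b : ℝ≥0) (hab : a < b) (α ε : ℝ)
    (hcontr : ∀ T ∈ Set.Ioo a b, IsContractingWith (P T) d α)
    (hsmall : ∀ T ∈ Set.Ioo a b, IsSmallWith (P T) d {x | V x ≤ 4 * K_V} ε) :
    ∃ γ : ℝ, 0 < γ ∧ ∃ t₀ : ℝ≥0, 0 < t₀ ∧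
      (∀ (μ ν : Measure H) [IsProbabilityMeasure μ] [IsProbabilityMeasure ν] (t : ℝ≥0), t₀ ≤ t →
        wassersteinSemimetric (weightedSemimetric d V) (μ.bind (P t)) (ν.bind (P t)) ≤
          ENNReal.ofReal (Real.exp (-γ * t)) *
            wassersteinSemimetric (weightedSemimetric d V) μ ν) ∧
      (∀ (μs : Measure H) [IsProbabilityMeasure μs], (∀ t, (P t).Invariant μs) →
        ∃ C : ℝ, 0 < C ∧ ∀ (x : H) (t : ℝ≥0), t₀ ≤ t →
          wassersteinSemimetric (weightedSemimetric d V) (P t x) μs ≤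
            ENNReal.ofReal (C * (1 + V x) * Real.exp (-γ * t))) := by
  obtain ⟨T₀, hT₀⟩ := exists_between hab
  obtain ⟨hα0, hα1, -⟩ := hcontr T₀ hT₀
  obtain ⟨hε0, hε1, -⟩ := hsmall T₀ hT₀
  obtain ⟨β, q, hβ0, hβ1, hq0, hq1, hstep⟩ := exists_weightedSemimetric_contraction hd.nonneg hd1
    hd.lsc.measurable hV.measurable hV.nonneg hV.K_pos hα1 hα0 hε0 hε1
  obtain ⟨t₁, ht₁0, ht₁⟩ : ∃ t₁ : ℝ≥0, 0 < t₁ ∧ ∀ s ≥ t₁, ∀ x y,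
      wassersteinSemimetric (weightedSemimetric d fun x => β * V x) (P s x) (P s y) ≤
        ENNReal.ofReal (q * weightedSemimetric d (fun x => β * V x) x y) := by
    obtain ⟨t₁, ht₁0, ht₁⟩ := exists_pos_forall_ge_mem_nsmul_Ioo hab
    -- After time `log(4 C_V) / γ_V` the Lyapunov factor `C_V e^{-γ_V s}` is at most `1/4`.
    refine ⟨max t₁ (Real.log (4 * C_V) / γ_V).toNNReal, lt_max_of_lt_left ht₁0, fun s hs => ?_⟩
    have := hP.markov s
    obtain ⟨n, T, hT, hnT⟩ := ht₁ s ((le_max_left _ _).trans hs)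
    have hTm := hP.markov T
    have hnonexp : ∀ x y, wassersteinSemimetric d (P T x) (P T y) ≤ ENNReal.ofReal (d x y) := by
      intro x y
      rcases (hd1 x y).lt_or_eq with hlt | heq
      · refine ((hcontr T hT).2.2 x y hlt).trans (ENNReal.ofReal_le_ofReal ?_)
        exact mul_le_of_le_one_left (hd.nonneg x y) hα1.le
      · simpa [heq] using wassersteinSemimetric_le_one hd1 (P T x) (P T y)
    have hle : ∀ x y, wassersteinSemimetric d (P s x) (P s y) ≤
        wassersteinSemimetric d (P T x) (P T y) := fun x y => by
      rw [hnT]; exact hP.wassersteinSemimetric_nsmul_le hd.nonneg hd.lsc hnonexp n x y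
    refine hstep (P s) (fun x => (hV.bound s x).trans (ENNReal.ofReal_le_ofReal ?_))
      (fun x y hxy => (hle x y).trans ((hcontr T hT).2.2 x y hxy))
      (fun x y hx hy => (hle x y).trans ((hsmall T hT).2.2 x hx y hy))
    have hlog : Real.log (4 * C_V) ≤ γ_V * s := by
      have h1 : Real.log (4 * C_V) / γ_V ≤ s :=
        Real.toNNReal_le_iff_le_coe.1 ((le_max_right _ _).trans hs)
      rw [div_le_iff₀ hV.κ_pos] at h1
      linarith
    have h4C : 0 < 4 * C_V := by linarith [hV.C_pos]
    have hexp : 4 * C_V * Real.exp (-γ_V * s) ≤ 1 := by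
      rw [← Real.exp_log h4C, ← Real.exp_add, Real.exp_le_one_iff]
      linarith
    nlinarith [hV.nonneg x]
  have hβV : ∀ x, 0 ≤ β * V x := fun x => mul_nonneg hβ0.le (hV.nonneg x)
  have hlsc := lowerSemicontinuous_weightedSemimetric hd.lsc (hVcont.const_mul β) hβV
  have hle₁ : ∀ x y, weightedSemimetric d V x y ≤
      Real.sqrt β⁻¹ * weightedSemimetric d (fun x => β * V x) x y := fun x y => by
    rw [weightedSemimetric, weightedSemimetric, ← Real.sqrt_mul (by positivity)]
    refine Real.sqrt_le_sqrt ?_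
    have h1 : β⁻¹ * (d x y * (1 + β * V x + β * V y)) = d x y * (β⁻¹ + V x + V y) := by
      field_simp
    rw [h1]
    have := hd.nonneg x y
    gcongr
    exact (one_le_inv₀ hβ0).2 hβ1
  have hle₂ : ∀ x y, weightedSemimetric d (fun x => β * V x) x y ≤
      1 * weightedSemimetric d V x y := fun x y => by
    rw [one_mul]
    refine Real.sqrt_le_sqrt (mul_le_mul_of_nonneg_left ?_ (hd.nonneg x y))
    nlinarith [hV.nonneg x, hV.nonneg y]
  set k := Real.sqrt β⁻¹ with hk
  have hk0 : 0 < k := Real.sqrt_pos.2 (inv_pos.2 hβ0)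
  -- Of the factor `4`, one `2` pays for `t ≤ 2 n t₁`; the other leaves a spare `e^{-γ t}` to absorb
  -- `k`.
  obtain ⟨γ, hγ, hγq⟩ : ∃ γ : ℝ, 0 < γ ∧ 4 * (γ * t₁) = -Real.log q := by
    have h1 := Real.log_neg hq0 hq1
    have h2 : (0 : ℝ) < t₁ := ht₁0
    refine ⟨-Real.log q / (4 * t₁), div_pos (by linarith) (by positivity), by field_simp⟩
  obtain ⟨t₀, ht₀0, ht₀₁, ht₀k⟩ : ∃ t₀ : ℝ≥0, 0 < t₀ ∧ t₁ ≤ t₀ ∧ Real.log k ≤ γ * t₀ := by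
    refine ⟨max t₁ (Real.log k / γ).toNNReal, lt_max_of_lt_left ht₁0, le_max_left _ _, ?_⟩
    rw [← div_le_iff₀' hγ]
    exact Real.toNNReal_le_iff_le_coe.1 (le_max_right _ _)
  have hmain : ∀ (μ ν : Measure H) [IsProbabilityMeasure μ] [IsProbabilityMeasure ν] (t : ℝ≥0),
      t₀ ≤ t → wassersteinSemimetric (weightedSemimetric d V) (μ.bind (P t)) (ν.bind (P t)) ≤
        ENNReal.ofReal (Real.exp (-γ * t)) *
          wassersteinSemimetric (weightedSemimetric d V) μ ν := by
    intro μ ν _ _ t ht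
    have hn1 : 1 ≤ t / t₁ := (one_le_div ht₁0).2 (ht₀₁.trans ht)
    -- `n` equal steps of length `t / n ≥ t₁` reach `t` exactly, so no remainder has to be
    -- estimated.
    obtain ⟨n, hn⟩ : ∃ n, n = ⌊t / t₁⌋₊ := ⟨_, rfl⟩
    have hn0 : 1 ≤ n := hn ▸ Nat.le_floor (by simpa using hn1)
    have hnpos : (0 : ℝ≥0) < n := by exact_mod_cast hn0
    have hs : t₁ ≤ t / n := by
      rw [le_div_iff₀ hnpos, mul_comm, ← le_div_iff₀ ht₁0, hn]
      exact Nat.floor_le zero_le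
    have hns : n • (t / n) = t := by
      rw [nsmul_eq_mul]; exact mul_div_cancel₀ _ hnpos.ne'
    have hnt : (t : ℝ) ≤ 2 * n * t₁ := by
      have h1 : t / t₁ < n + 1 := hn ▸ Nat.lt_floor_add_one (t / t₁)
      rw [div_lt_iff₀ ht₁0] at h1
      have h2 : (t : ℝ) < (n + 1) * t₁ := by exact_mod_cast h1
      have h3 : (1 : ℝ) ≤ n := by exact_mod_cast hn0
      nlinarith [t₁.coe_nonneg]
    have hexp : k * q ^ n ≤ Real.exp (-γ * t) := by
      rw [← Real.exp_log (mul_pos hk0 (pow_pos hq0 n)), Real.exp_le_exp,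
        Real.log_mul hk0.ne' (pow_pos hq0 n).ne', Real.log_pow]
      have h1 : Real.log k ≤ γ * t := ht₀k.trans (by gcongr)
      have h2 : γ * t ≤ γ * (2 * n * t₁) := by gcongr
      have h3 : (n : ℝ) * Real.log q = -(2 * (γ * (2 * n * t₁))) := by
        linear_combination (n : ℝ) * hγq
      rw [h3]
      linarith
    have hiter := hP.wassersteinSemimetric_bind_nsmul_le (weightedSemimetric_nonneg d _) hlsc hq0
      (ht₁ _ hs) μ ν n
    rw [hns] at hiter
    calc _ ≤ ENNReal.ofReal k * wassersteinSemimetric (weightedSemimetric d fun x => β * V x)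
          (μ.bind (P t)) (ν.bind (P t)) := wassersteinSemimetric_le_mul hk0 hle₁ _ _
      _ ≤ ENNReal.ofReal k * (ENNReal.ofReal (q ^ n) *
          wassersteinSemimetric (weightedSemimetric d V) μ ν) := by
        gcongr
        refine hiter.trans ?_
        gcongr
        simpa using wassersteinSemimetric_le_mul one_pos hle₂ μ ν
      _ = ENNReal.ofReal (k * q ^ n) * wassersteinSemimetric (weightedSemimetric d V) μ ν := by
        rw [← mul_assoc, ENNReal.ofReal_mul hk0.le]
      _ ≤ _ := by gcongr
  refine ⟨γ, hγ, t₀, ht₀0, hmain, fun μs _ hinv => ⟨1 + K_V, by linarith [hV.K_pos],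
    fun x t ht => ?_⟩⟩
  have h := hmain (Measure.dirac x) μs t ht
  rw [Measure.dirac_bind (P t).measurable, (hinv t).def] at h
  refine h.trans ?_
  have hx := hV.nonneg x
  have hK := hV.K_pos
  -- With `d ≤ 1` and `V`-moment at most `K_V` under `μs`, the initial distance is at most `√(1 + V
  -- x + K_V)`.
  have hW := wassersteinSemimetric_weightedSemimetric_le (μ := Measure.dirac x) (ν := μs)
    (A := 1) (B := 1 + V x + K_V) hd.nonneg
    hd.lsc.measurable hV.measurable hV.nonneg zero_le_one (by positivity)
    (by simpa using wassersteinSemimetric_le_one hd1 _ _) (by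
      rw [lintegral_dirac' _ hV.measurable.ennreal_ofReal, ENNReal.ofReal_add (by positivity) hK.le,
        ENNReal.ofReal_add zero_le_one hx, ENNReal.ofReal_one]
      gcongr
      exact hV.lintegral_le_of_invariant hP hinv)
  calc _ ≤ ENNReal.ofReal (Real.exp (-γ * t)) * ENNReal.ofReal ((1 + K_V) * (1 + V x)) := by
        gcongr
        refine hW.trans (ENNReal.ofReal_le_ofReal ?_)
        rw [one_mul]
        refine Real.sqrt_le_iff.2 ⟨by positivity, ?_⟩
        have h1 : 1 + V x + K_V ≤ (1 + K_V) * (1 + V x) := by nlinarith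
        have h2 : 1 ≤ (1 + K_V) * (1 + V x) := by nlinarith
        nlinarith
    _ = _ := by rw [← ENNReal.ofReal_mul (Real.exp_nonneg _), mul_comm]
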